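/- Let $X$ be a finite metric space and let $\Bbbk$ be a field. For $x_0,\dots,x_k\in X$ put $\ell(x_0,\dots,x_k)=\sum_{i=1}^{k}d(x_{i-1},x_i)$. For $l\in\mathbb R$ let $\mathrm{BMC}_k(X)(l)$ be the $\Bbbk$-vector space with basis the tuples $(x_0,\dots,x_k)\in X^{k+1}$ such that $x_{i-1}\neq x_i$ for all $i$ and $\ell(x_0,\dots,x_k)\le l$. With the boundary operators $\partial(x_0,\dots,x_k)=\sum_{i=0}^{k}(-1)^i(x_0,\dots,\widehat{x_i},\dots,x_k)$, in which a tuple with two equal consecutive entries is read as $0$, and with the inclusions $\mathrm{BMC}_k(X)(l)\subseteq \mathrm{BMC}_k(X)(l')$ for $l\le l'$, these spaces form a chain complex of persistence modules (functors from $(\mathbb R,\le)$ to $\Bbbk$-vector spaces). Its homology $\mathrm{BMH}_*(X)$ is the blurred magnitude homology of $X$. Suppose that for every $k\ge 0$ the persistence module $\mathrm{BMH}_k(X)$ has barcode consisting of the bars $[a_{k,i},b_{k,i})$, $i\in I_k$, where $-\infty<a_{k,i}<b_{k,i}\le\infty$; that is, $\mathrm{BMH}_k(X)\cong\bigoplus_{i\in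 I_k}\Bbbk[a_{k,i},b_{k,i})$, where $\Bbbk[a,b)$ denotes the interval module. Then each $I_k$ is finite, and for all sufficiently large $t>0$ (how large depending only on $X$ and $\Bbbk$) the magnitude $|tX|$ is defined, the following series converges absolutely, and $$|tX|=\sum_{k=0}^{\infty}\sum_{i\in I_k}(-1)^k\left(e^{-a_{k,i}t}-e^{-b_{k,i}t}\right),\qquad e^{-\infty}=0 .$$ Here $tX$ is $X$ with all distances multiplied by $t$. The magnitude $|tX|$ is defined if there is a weighting, i.e. a function $w\colon X\to\mathbb R$ with $\sum_{y\in X}e^{-t\,d(x,y)}w(y)=1$ for all $x\in X$; it is then $\sum_{x\in X}w(x)$, which does not depend on the choice of $w$. -/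

import Mathlib

open CategoryTheory

universe u v w w₁ w₂

noncomputable section

namespace BlurredMagnitude

/-! ### Magnitude of finite metric spaces -/

/-- `w` is a weighting for the distance function `d` on the finite set `X`. -/
def IsWeighting {X : Type u} [Fintype X] (d : X → X → ℝ) (w : X → ℝ) : Prop :=
  ∀ x, ∑ y, Real.exp (-d x y) * w y = 1

/-- The magnitude of the finite set `X` with distance function `d` is defined (that is, a weighting
exists) and is equal to `m` (for whichever weighting it is computed from). -/
def HasMagnitude {X : Type u} [Fintype X] (d : X → X → ℝ) (m : ℝ) : Prop :=
  (∃ w, IsWeighting d w) ∧ ∀ w, IsWeighting d w → ∑ x, w x = m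

/-! ### Persistence modules and barcodes -/

/-- Persistence modules over `𝕜`: functors from the poset `(ℝ, ≤)` to `𝕜`-vector spaces. -/
abbrev PersistenceModule (𝕜 : Type v) [Field 𝕜] := ℝ ⥤ ModuleCat.{w} 𝕜

/-- Isomorphism of persistence modules, i.e. a family of linear isomorphisms commuting with all
structure maps (spelled out so that the vector spaces may live in different universes). -/
def PersistenceModule.Isomorphic {𝕜 : Type v} [Field 𝕜]
    (M : PersistenceModule.{v, w₁} 𝕜) (N : PersistenceModule.{v, w₂} 𝕜) : Prop :=
  ∃ e : ∀ x : ℝ, M.obj x ≃ₗ[𝕜] N.obj x,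
    ∀ (x y : ℝ) (f : x ⟶ y) (m : M.obj x), e y (M.map f m) = N.map f (e x m)

/-- The direct sum of a family of persistence modules. -/
def PersistenceModule.directSum {𝕜 : Type v} [Field 𝕜] {ι : Type w}
    (M : ι → PersistenceModule.{v, w₁} 𝕜) : PersistenceModule.{v, max w w₁} 𝕜 where
  obj x := ModuleCat.of 𝕜 (DirectSum ι fun i => (M i).obj x)
  map f := ModuleCat.ofHom (DirectSum.lmap fun i => ((M i).map f).hom)
  map_id x := by
    ext : 1
    simp only [CategoryTheory.Functor.map_id, ModuleCat.hom_id, ModuleCat.hom_ofHom]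
    exact DirectSum.lmap_id
  map_comp f g := by
    ext : 1
    simp only [CategoryTheory.Functor.map_comp, ModuleCat.hom_comp, ModuleCat.hom_ofHom]
    exact DirectSum.lmap_comp _ _

/-- For increasing families `B x ≤ Z x` of subspaces of a fixed space, the persistence module
`x ↦ Z x / B x`, whose structure maps are induced by the inclusions `Z x ≤ Z y`. -/
def PersistenceModule.subquotient {𝕜 : Type v} [Field 𝕜] {V : Type w} [AddCommGroup V]
    [Module 𝕜 V] (Z B : ℝ → Submodule 𝕜 V) (hZ : Monotone Z) (hB : Monotone B)
    (_hBZ : ∀ x, B x ≤ Z x) :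
    PersistenceModule.{v, w} 𝕜 where
  obj x := ModuleCat.of 𝕜 (Z x ⧸ (B x).submoduleOf (Z x))
  map {x y} f := ModuleCat.ofHom <|
    Submodule.mapQ ((B x).submoduleOf (Z x)) ((B y).submoduleOf (Z y))
      (Submodule.inclusion (hZ (leOfHom f))) (fun _ h => hB (leOfHom f) h)
  map_id x := by
    ext : 1
    apply Submodule.linearMap_qext
    rfl
  map_comp f g := by
    ext : 1
    apply Submodule.linearMap_qext
    rfl

/-- The half-open interval `[a, b)`, with `b` possibly infinite. -/
def bar (a : ℝ) (b : WithTop ℝ) : Set ℝ := {x | a ≤ x ∧ (x : WithTop ℝ) < b}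

/-- The value at `x` of the interval module on `J`: it is `𝕜` if `x ∈ J` and `0` otherwise. -/
def intervalFiber (𝕜 : Type v) [Field 𝕜] (J : Set ℝ) (x : ℝ) : Submodule 𝕜 𝕜 where
  carrier := {c | x ∉ J → c = 0}
  add_mem' h₁ h₂ hx := by rw [h₁ hx, h₂ hx, add_zero]
  zero_mem' _ := rfl
  smul_mem' c _ h hx := by rw [h hx, smul_zero]

open Classical in
/-- The structure map from `x` to `y` of the interval module on `J`: the identity of `𝕜` if both
`x` and `y` are in `J`, and `0` otherwise. -/
def intervalMap (𝕜 : Type v) [Field 𝕜] (J : Set ℝ) (x y : ℝ) :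
    intervalFiber 𝕜 J x →ₗ[𝕜] intervalFiber 𝕜 J y where
  toFun c := ⟨if x ∈ J ∧ y ∈ J then c else 0, fun hy => if_neg fun h => hy h.2⟩
  map_add' c c' := by
    ext
    by_cases h : x ∈ J ∧ y ∈ J <;> simp [h]
  map_smul' r c := by
    ext
    by_cases h : x ∈ J ∧ y ∈ J <;> simp [h]

/-- The interval module `𝕜[a, b)`. -/
def intervalModule (𝕜 : Type v) [Field 𝕜] (a : ℝ) (b : WithTop ℝ) :
    PersistenceModule.{v, v} 𝕜 where
  obj x := ModuleCat.of 𝕜 (intervalFiber 𝕜 (bar a b) x)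
  map {x y} _ := ModuleCat.ofHom (intervalMap 𝕜 (bar a b) x y)
  map_id x := by
    ext c
    by_cases h : x ∈ bar a b
    · simp [intervalMap, h]
    · simpa [intervalMap, h] using (c.2 h).symm
  map_comp {x y z} f g := by
    ext c
    by_cases hx : x ∈ bar a b
    · by_cases hz : z ∈ bar a b
      · have hy : y ∈ bar a b :=
          ⟨hx.1.trans (leOfHom f), (WithTop.coe_le_coe.2 (leOfHom g)).trans_lt hz.2⟩
        simp [intervalMap, hx, hy, hz]
      · simp [intervalMap, hz]
    · simp [intervalMap, hx]

/-- The (nonempty) intervals `[a i, b i)`, `i : ι`, are the bars of a barcode decomposition of `M`,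
counted with multiplicity: `M` is isomorphic to the direct sum of the interval modules
`𝕜[a i, b i)`. -/
def IsBarcode {𝕜 : Type v} [Field 𝕜] (M : PersistenceModule.{v, w₁} 𝕜) {ι : Type w}
    (a : ι → ℝ) (b : ι → WithTop ℝ) : Prop :=
  (∀ i, (a i : WithTop ℝ) < b i) ∧
    M.Isomorphic (PersistenceModule.directSum fun i => intervalModule 𝕜 (a i) (b i))

/-- `e^{-bt}`, with the convention `e^{-∞} = 0`. -/
def expNegMul (b : WithTop ℝ) (t : ℝ) : ℝ :=
  WithTop.recTopCoe (C := fun _ => ℝ) 0 (fun r => Real.exp (-(r * t))) b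

/-! ### Blurred magnitude homology -/

/-- No two consecutive entries of `(x₀, …, xₖ)` are equal. -/
def Nondegenerate {X : Type u} {k : ℕ} (x : Fin (k + 1) → X) : Prop :=
  ∀ i : Fin k, x i.castSucc ≠ x i.succ

/-- The tuples `(x₀, …, xₖ)` with consecutive entries distinct. -/
abbrev Tuple (X : Type u) (k : ℕ) := {x : Fin (k + 1) → X // Nondegenerate x}

/-- `ℓ(x₀, …, xₖ) = d(x₀, x₁) + ⋯ + d(xₖ₋₁, xₖ)`. -/
def length {X : Type u} [MetricSpace X] {k : ℕ} (x : Fin (k + 1) → X) : ℝ :=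
  ∑ i : Fin k, dist (x i.castSucc) (x i.succ)

open Classical in
/-- The basis element of a tuple, or `0` if two consecutive entries are equal. -/
def gen {X : Type u} (𝕜 : Type v) [Field 𝕜] {k : ℕ} (x : Fin (k + 1) → X) : Tuple X k →₀ 𝕜 :=
  if h : Nondegenerate x then Finsupp.single ⟨x, h⟩ 1 else 0

/-- The boundary operator
`∂(x₀, …, xₖ₊₁) = ∑ᵢ (-1)ⁱ (x₀, …, x̂ᵢ, …, xₖ₊₁)` on the union of all filtration stages, where
tuples with two equal consecutive entries count as `0`. -/
def boundary (X : Type u) (𝕜 : Type v) [Field 𝕜] (k : ℕ) :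
    (Tuple X (k + 1) →₀ 𝕜) →ₗ[𝕜] (Tuple X k →₀ 𝕜) :=
  Finsupp.linearCombination 𝕜 fun x : Tuple X (k + 1) =>
    ∑ i : Fin (k + 2), (-1 : 𝕜) ^ (i : ℕ) • gen 𝕜 (i.removeNth x.1)

/-- `BMC_k(X)(l)`: the vector space with basis the tuples `(x₀, …, xₖ)` with consecutive entries
distinct and length at most `l`. -/
def chains (X : Type u) [MetricSpace X] (𝕜 : Type v) [Field 𝕜] (k : ℕ) (l : ℝ) :
    Submodule 𝕜 (Tuple X k →₀ 𝕜) :=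
  Finsupp.supported 𝕜 𝕜 {x | length x.1 ≤ l}

/-- The `k`-cycles of `BMC_*(X)(l)`; every `0`-chain is a cycle. -/
def cycles (X : Type u) [MetricSpace X] (𝕜 : Type v) [Field 𝕜] :
    (k : ℕ) → (l : ℝ) → Submodule 𝕜 (Tuple X k →₀ 𝕜)
  | 0, l => chains X 𝕜 0 l
  | k + 1, l => chains X 𝕜 (k + 1) l ⊓ LinearMap.ker (boundary X 𝕜 k)

/-- The `k`-boundaries of `BMC_*(X)(l)`. -/
def boundaries (X : Type u) [MetricSpace X] (𝕜 : Type v) [Field 𝕜] (k : ℕ) (l : ℝ) :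
    Submodule 𝕜 (Tuple X k →₀ 𝕜) :=
  (chains X 𝕜 (k + 1) l).map (boundary X 𝕜 k)

theorem chains_mono (X : Type u) [MetricSpace X] (𝕜 : Type v) [Field 𝕜] (k : ℕ) :
    Monotone (chains X 𝕜 k) :=
  fun _ _ h => Finsupp.supported_mono fun _ hx => le_trans hx h

theorem cycles_mono (X : Type u) [MetricSpace X] (𝕜 : Type v) [Field 𝕜] (k : ℕ) :
    Monotone (cycles X 𝕜 k) := by
  intro l l' h
  cases k with
  | zero => exact chains_mono X 𝕜 0 h
  | succ k => exact inf_le_inf_right _ (chains_mono X 𝕜 (k + 1) h)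

theorem boundaries_mono (X : Type u) [MetricSpace X] (𝕜 : Type v) [Field 𝕜] (k : ℕ) :
    Monotone (boundaries X 𝕜 k) :=
  fun _ _ h => Submodule.map_mono (chains_mono X 𝕜 (k + 1) h)

theorem length_succ {X : Type u} [MetricSpace X] {k : ℕ} (x : Fin (k + 2) → X) :
    length x = dist (x 0) (x 1) + length (Fin.tail x) := by
  simp only [length, Fin.sum_univ_succ (n := k)]
  rfl

theorem length_nonneg {X : Type u} [MetricSpace X] {k : ℕ} (x : Fin (k + 1) → X) :
    0 ≤ length x := Finset.sum_nonneg fun _ _ => dist_nonneg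

theorem length_removeNth_le {X : Type u} [MetricSpace X] {k : ℕ} (x : Fin (k + 2) → X)
    (i : Fin (k + 2)) : length (i.removeNth x) ≤ length x := by
  induction k with
  | zero => simp [length]
  | succ k ih =>
    rw [length_succ x]
    induction i using Fin.cases with
    | zero => exact le_add_of_nonneg_left dist_nonneg
    | succ i =>
      have h : Fin.tail (i.succ.removeNth x) = i.removeNth (Fin.tail x) := by
        ext j
        simp [Fin.tail, Fin.removeNth]
      rw [length_succ, h]
      induction i using Fin.cases with
      | zero =>
        rw [length_succ (Fin.tail x), ← add_assoc]
        exact add_le_add (dist_triangle _ _ _) le_rfl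
      | succ i => exact add_le_add le_rfl (ih (Fin.tail x) i.succ)

theorem gen_mem_chains {X : Type u} [MetricSpace X] (𝕜 : Type v) [Field 𝕜] {k : ℕ}
    (x : Fin (k + 1) → X) {l : ℝ} (h : length x ≤ l) : gen 𝕜 x ∈ chains X 𝕜 k l := by
  unfold gen
  split_ifs with hx
  · exact Finsupp.single_mem_supported 𝕜 1 h
  · exact zero_mem _

/-- The boundary operator is compatible with the filtration. -/
theorem boundaries_le_chains (X : Type u) [MetricSpace X] (𝕜 : Type v) [Field 𝕜] (k : ℕ) (l : ℝ) :
    boundaries X 𝕜 k l ≤ chains X 𝕜 k l := by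
  rw [boundaries, chains, Finsupp.supported_eq_span_single, Submodule.map_span_le]
  rintro _ ⟨x, hx, rfl⟩
  simp only [boundary, Finsupp.linearCombination_single, one_smul]
  exact Submodule.sum_mem _ fun i _ => Submodule.smul_mem _ _
    (gen_mem_chains 𝕜 _ ((length_removeNth_le x.1 i).trans hx))

theorem boundary_gen (X : Type u) (𝕜 : Type v) [Field 𝕜] {k : ℕ} (x : Fin (k + 2) → X) :
    boundary X 𝕜 k (gen 𝕜 x) =
      ∑ i : Fin (k + 2), (-1 : 𝕜) ^ (i : ℕ) • gen 𝕜 (i.removeNth x) := by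
  by_cases hx : Nondegenerate x
  · simp [gen, hx, boundary]
  · rw [gen, dif_neg hx, map_zero]
    obtain ⟨j, hj⟩ : ∃ j : Fin (k + 1), x j.castSucc = x j.succ := by
      simpa [Nondegenerate] using hx
    have hne : j.castSucc ≠ j.succ := (Fin.castSucc_lt_succ).ne
    rw [Finset.sum_eq_add_of_mem j.castSucc j.succ (Finset.mem_univ _) (Finset.mem_univ _) hne]
    · have : j.castSucc.removeNth x = j.succ.removeNth x := by
        ext m
        simp only [Fin.removeNth]
        rcases lt_trichotomy m j with h | rfl | h
        · rw [Fin.succAbove_of_castSucc_lt _ _ (Fin.castSucc_lt_castSucc_iff.2 h),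
            Fin.succAbove_of_castSucc_lt _ _
              (by simp only [Fin.lt_def, Fin.val_castSucc, Fin.val_succ] at h ⊢; omega)]
        · simp [hj]
        · rw [Fin.succAbove_of_le_castSucc _ _ (Fin.castSucc_le_castSucc_iff.2 h.le),
            Fin.succAbove_of_le_castSucc _ _ (by simpa [Fin.le_def] using h)]
      rw [this]
      simp [pow_succ]
    · rintro i - ⟨h1, h2⟩
      rw [gen, dif_neg, smul_zero]
      have h1' : (i : ℕ) ≠ j := fun h => h1 (Fin.ext h)
      have h2' : (i : ℕ) ≠ j + 1 := fun h => h2 (Fin.ext h)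
      have hi := i.2
      have hj' := j.2
      intro hd
      rcases lt_or_gt_of_ne h1' with h | h
      · have e1 : i.succAbove (Fin.castSucc ⟨j - 1, by omega⟩ : Fin (k + 1)) = j.castSucc := by
          rw [Fin.succAbove_of_le_castSucc _ _ (by simp only [Fin.le_def, Fin.val_castSucc]; omega)]
          ext
          simp only [Fin.val_succ, Fin.val_castSucc]
          omega
        have e2 : i.succAbove (Fin.succ ⟨j - 1, by omega⟩ : Fin (k + 1)) = j.succ := by
          rw [Fin.succAbove_of_le_castSucc _ _
            (by simp only [Fin.le_def, Fin.val_castSucc, Fin.val_succ]; omega)]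
          ext
          simp only [Fin.val_succ]
          omega
        apply hd ⟨j - 1, by omega⟩
        rw [Fin.removeNth, Fin.removeNth, e1, e2, hj]
      · have e1 : i.succAbove (Fin.castSucc ⟨j, by omega⟩ : Fin (k + 1)) = j.castSucc := by
          rw [Fin.succAbove_of_castSucc_lt _ _ (by simp only [Fin.lt_def, Fin.val_castSucc]; omega)]
          rfl
        have e2 : i.succAbove (Fin.succ ⟨j, by omega⟩ : Fin (k + 1)) = j.succ := by
          rw [Fin.succAbove_of_castSucc_lt _ _
            (by simp only [Fin.lt_def, Fin.val_castSucc, Fin.val_succ]; omega)]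
          rfl
        apply hd ⟨j, by omega⟩
        rw [Fin.removeNth, Fin.removeNth, e1, e2, hj]

theorem removeNth_removeNth {X : Type u} {k : ℕ} (x : Fin (k + 3) → X) {i j : Fin (k + 2)}
    (h : i ≤ j) : i.removeNth (j.succ.removeNth x) = j.removeNth (i.castSucc.removeNth x) := by
  ext m
  simp only [Fin.removeNth]
  congr 1
  have := SimplexCategory.δ_comp_δ (n := k) h
  exact congrArg (fun f => SimplexCategory.Hom.toOrderHom f m) this

/-- `∂ ∘ ∂ = 0`. -/
theorem boundary_boundary (X : Type u) (𝕜 : Type v) [Field 𝕜] (k : ℕ) :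
    boundary X 𝕜 k ∘ₗ boundary X 𝕜 (k + 1) = 0 := by
  refine Finsupp.lhom_ext' fun x => LinearMap.ext_ring ?_
  have hx : Finsupp.single x (1 : 𝕜) = gen 𝕜 x.1 := by rw [gen, dif_pos x.2]
  simp only [LinearMap.comp_apply, Finsupp.lsingle_apply, LinearMap.zero_apply, hx, boundary_gen,
    map_sum, map_smul, Finset.smul_sum, smul_smul, ← pow_add]
  rw [← Finset.sum_product', Finset.univ_product_univ]
  let S : Finset (Fin (k + 3) × Fin (k + 2)) := {p | (p.1 : ℕ) ≤ (p.2 : ℕ)}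
  rw [← Finset.sum_add_sum_compl S, ← eq_neg_iff_add_eq_zero, ← Finset.sum_neg_distrib]
  let φ : ∀ p : Fin (k + 3) × Fin (k + 2), p ∈ S → Fin (k + 3) × Fin (k + 2) := fun p hp =>
    (p.2.succ, p.1.castLT (lt_of_le_of_lt (Finset.mem_filter.mp hp).right (Fin.is_lt p.2)))
  apply Finset.sum_bij φ
  · intro p hp
    simp_rw [S, φ, Finset.compl_filter, Finset.mem_filter_univ, Fin.val_succ,
      Fin.val_castLT] at hp ⊢
    lia
  · rintro ⟨i, j⟩ hij ⟨i', j'⟩ hij' h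
    simp only [φ, Prod.mk.injEq, Fin.ext_iff, Fin.val_castLT, Fin.val_succ] at h ⊢
    exact ⟨h.2, by lia⟩
  · rintro ⟨i', j'⟩ hij'
    simp_rw [S, Finset.compl_filter, Finset.mem_filter_univ, not_le] at hij'
    refine ⟨(Fin.castSucc j', i'.pred ?_), ?_, ?_⟩
    · rintro rfl
      simp only [Fin.val_zero, not_lt_zero] at hij'
    · simpa [S] using Nat.le_sub_one_of_lt hij'
    · simp only [φ, Fin.castLT_castSucc, Fin.succ_pred]
  · rintro ⟨i, j⟩ hij
    have hle : (i : ℕ) ≤ j := by simpa [S] using hij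
    have hi : (i.castLT (lt_of_le_of_lt hle j.2)).castSucc = i := Fin.castSucc_castLT _ _
    have := removeNth_removeNth x.1 (i := i.castLT (lt_of_le_of_lt hle j.2)) (j := j) hle
    rw [hi] at this
    simp only [φ, this, ← neg_smul, Fin.val_succ, Fin.val_castLT]
    congr 1
    ring

theorem boundaries_le_cycles (X : Type u) [MetricSpace X] (𝕜 : Type v) [Field 𝕜] (k : ℕ) (l : ℝ) :
    boundaries X 𝕜 k l ≤ cycles X 𝕜 k l := by
  cases k with
  | zero => exact boundaries_le_chains X 𝕜 0 l
  | succ k =>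
    refine le_inf (boundaries_le_chains X 𝕜 (k + 1) l) ?_
    rintro _ ⟨c, -, rfl⟩
    exact LinearMap.congr_fun (boundary_boundary X 𝕜 k) c

/-- The blurred magnitude homology `BMH_k(X)`: cycles modulo boundaries at each stage `l`, with
structure maps induced by the inclusions `BMC_k(X)(l) ⊆ BMC_k(X)(l')`. -/
def BMH (X : Type u) [MetricSpace X] (𝕜 : Type v) [Field 𝕜] (k : ℕ) :
    PersistenceModule.{v, max u v} 𝕜 :=
  PersistenceModule.subquotient (cycles X 𝕜 k) (boundaries X 𝕜 k)
    (cycles_mono X 𝕜 k) (boundaries_mono X 𝕜 k) (boundaries_le_cycles X 𝕜 k)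

end BlurredMagnitude

end

noncomputable section

namespace BlurredMagnitude

/-! ### Barcodes of pointwise finite-dimensional persistence modules -/

/-! Write `L g = t ∫ g(l) e^{-tl} dl`. It sends the indicator of `[a, b)` to `e^{-at} - e^{-bt}`.
Hence `L` of `dim BMH_k(l)` is the sum over the bars in degree `k` (`IsBarcode.laplace_finrank`),
and `L` of `dim BMC_k(l)` is the sum of `e^{-tℓ(x)}` over tuples (`laplace_finrank_chains`).

At each `l`, rank-nullity gives `dim C_k = dim H_k + dim B_k + dim B_{k-1}`, and `L` preserves this
identity degree by degree. For large `t` the series of the `L(dim C_k)` converges; it dominates that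
of the `L(dim B_k)`, so the boundary terms cancel in the alternating sum
(`hasSum_neg_one_pow_mul_of_add_eq`). No infinite sum is ever exchanged with the integral.

For the magnitude, the similarity matrix of `tX` is `1 + A` with `A` its off-diagonal part. Once the
row sums of `A` are at most `1/2`, the Neumann series `∑ (-1)^k A^k 1` is a weighting, and its total
is the alternating sum of `e^{-tℓ}` over tuples (`exists_hasMagnitude_hasSum`).

Finiteness of the barcode: a bar is born only where new cycles appear, hence at one of finitely many
tuple lengths, and only finitely many bars contain a given point because homology is pointwise
finite-dimensional. -/

theorem intervalFiber_eq_top {𝕜 : Type v} [Field 𝕜] {J : Set ℝ} {x : ℝ} (hx : x ∈ J) :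
    intervalFiber 𝕜 J x = ⊤ :=
  eq_top_iff.2 fun _ _ h => absurd hx h

theorem intervalFiber_eq_bot {𝕜 : Type v} [Field 𝕜] {J : Set ℝ} {x : ℝ} (hx : x ∉ J) :
    intervalFiber 𝕜 J x = ⊥ :=
  eq_bot_iff.2 fun _ h => (Submodule.mem_bot 𝕜).2 (h hx)

theorem finrank_intervalFiber {𝕜 : Type v} [Field 𝕜] (J : Set ℝ) (x : ℝ) :
    (Module.finrank 𝕜 (intervalFiber 𝕜 J x) : ℝ) = J.indicator 1 x := by
  by_cases hx : x ∈ J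
  · rw [intervalFiber_eq_top hx]
    simp [hx]
  · rw [intervalFiber_eq_bot hx]
    simp [hx]

/-- The direct sum of the values at `x` of the interval modules on `J i`, `i : ι`, has a linearly
independent family indexed by the `i` with `x ∈ J i`. -/
theorem exists_linearIndependent_directSum_intervalFiber {𝕜 : Type v} [Field 𝕜] {ι : Type w}
    (J : ι → Set ℝ) (x : ℝ) :
    ∃ f : {i // x ∈ J i} → DirectSum ι fun i => intervalFiber 𝕜 (J i) x,
      LinearIndependent 𝕜 f := by
  classical
  refine ⟨fun i => DirectSum.lof 𝕜 ι (fun i => intervalFiber 𝕜 (J i) x) i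
    ⟨1, fun h => absurd i.2 h⟩, ?_⟩
  rw [linearIndependent_iff']
  intro s g hg i hi
  -- The `i`-th component isolates the coefficient `g i`.
  have h := congrArg (fun z => ((DirectSum.component 𝕜 ι _ i.1 z :
    intervalFiber 𝕜 (J i) x) : 𝕜)) hg
  simp only [map_sum, map_smul, map_zero] at h
  rw [Finset.sum_eq_single i] at h
  · simpa [DirectSum.component.lof_self] using h
  · intro j _ hj
    rw [DirectSum.component.of, dif_neg (fun e => hj (Subtype.ext e)), smul_zero]
  · exact fun h => absurd hi h

/-- The bars through `x` give linearly independent vectors in `M.obj x`. The index type may be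
infinite here, since its finiteness is deduced from this. -/
theorem IsBarcode.finite_setOf_mem_bar {𝕜 : Type v} [Field 𝕜] {M : PersistenceModule.{v, w₁} 𝕜}
    {ι : Type w} {a : ι → ℝ} {b : ι → WithTop ℝ} (h : IsBarcode M a b) (x : ℝ)
    [Module.Finite 𝕜 (M.obj x)] : {i | x ∈ bar (a i) (b i)}.Finite := by
  obtain ⟨-, e, -⟩ := h
  obtain ⟨f, hf⟩ := exists_linearIndependent_directSum_intervalFiber (𝕜 := 𝕜)
    (fun i => bar (a i) (b i)) x
  have hf' := hf.map' (e x).symm.toLinearMap (e x).symm.ker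
  exact hf'.finite

theorem IsBarcode.finrank_obj {𝕜 : Type v} [Field 𝕜] {M : PersistenceModule.{v, w₁} 𝕜}
    {ι : Type w} [Fintype ι] {a : ι → ℝ} {b : ι → WithTop ℝ} (h : IsBarcode M a b) (x : ℝ) :
    (Module.finrank 𝕜 (M.obj x) : ℝ) = ∑ i, (bar (a i) (b i)).indicator 1 x := by
  obtain ⟨-, e, -⟩ := h
  rw [(e x).finrank_eq]
  have := Module.finrank_directSum 𝕜 fun i => intervalFiber 𝕜 (bar (a i) (b i)) x
  simp only [← finrank_intervalFiber (𝕜 := 𝕜)]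
  exact_mod_cast this

/-- At the left end of a bar, a new class is born. -/
theorem IsBarcode.not_surjective_map {𝕜 : Type v} [Field 𝕜] {M : PersistenceModule.{v, w₁} 𝕜}
    {ι : Type w} {a : ι → ℝ} {b : ι → WithTop ℝ} (h : IsBarcode M a b) (i : ι) {x : ℝ}
    (hx : x < a i) : ¬ Function.Surjective (M.map (homOfLE hx.le)) := by
  classical
  obtain ⟨hab, e, he⟩ := h
  intro hs
  have hi : a i ∈ bar (a i) (b i) := ⟨le_rfl, hab i⟩
  -- Lift the generator of the `i`-th summand to `x`. Its `i`-th component would be both `1` and the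
  -- image of something under a zero map, as `x` lies before the bar.
  obtain ⟨m, hm⟩ := hs ((e (a i)).symm (DirectSum.lof 𝕜 ι
    (fun j => intervalFiber 𝕜 (bar (a j) (b j)) (a i)) i ⟨1, fun h => absurd hi h⟩))
  have h1 := ((e (a i)).apply_symm_apply _).symm.trans
    ((congrArg (e (a i)) hm).symm.trans (he _ _ (homOfLE hx.le) m))
  have h2 := congrArg (fun z => ((DirectSum.component 𝕜 ι
    (fun j => intervalFiber 𝕜 (bar (a j) (b j)) (a i)) i z :
    intervalFiber 𝕜 (bar (a i) (b i)) (a i)) : 𝕜)) h1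
  have hx' : x ∉ bar (a i) (b i) := fun h => hx.not_ge h.1
  have h3 : ∀ c, (intervalMap 𝕜 (bar (a i) (b i)) x (a i) c : 𝕜) = 0 := by
    intro c
    simp [intervalMap, hx']
  rw [DirectSum.component.lof_self] at h2
  exact one_ne_zero (h2.trans (h3 _))

/-- Only new cycles can obstruct surjectivity; new boundaries merely enlarge the subspace divided
out. -/
theorem PersistenceModule.subquotient_map_surjective {𝕜 : Type v} [Field 𝕜] {V : Type w}
    [AddCommGroup V] [Module 𝕜 V] {Z B : ℝ → Submodule 𝕜 V} (hZ : Monotone Z) (hB : Monotone B)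
    (hBZ : ∀ x, B x ≤ Z x) {x y : ℝ} (f : x ⟶ y) (h : Z y ≤ Z x) :
    Function.Surjective ((PersistenceModule.subquotient Z B hZ hB hBZ).map f) := by
  intro q
  obtain ⟨z, rfl⟩ := Submodule.Quotient.mk_surjective _ q
  exact ⟨Submodule.Quotient.mk ⟨z.1, h z.2⟩, rfl⟩

theorem PersistenceModule.finite_subquotient_obj {𝕜 : Type v} [Field 𝕜] {V : Type w}
    [AddCommGroup V] [Module 𝕜 V] [Module.Finite 𝕜 V] {Z B : ℝ → Submodule 𝕜 V} (hZ : Monotone Z)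
    (hB : Monotone B) (hBZ : ∀ x, B x ≤ Z x) (x : ℝ) :
    Module.Finite 𝕜 ((PersistenceModule.subquotient Z B hZ hB hBZ).obj x) :=
  inferInstanceAs (Module.Finite 𝕜 (Z x ⧸ (B x).submoduleOf (Z x)))

theorem PersistenceModule.finrank_subquotient_obj_add {𝕜 : Type v} [Field 𝕜] {V : Type w}
    [AddCommGroup V] [Module 𝕜 V] [Module.Finite 𝕜 V] {Z B : ℝ → Submodule 𝕜 V} (hZ : Monotone Z)
    (hB : Monotone B) (hBZ : ∀ x, B x ≤ Z x) (x : ℝ) :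
    Module.finrank 𝕜 ((PersistenceModule.subquotient Z B hZ hB hBZ).obj x) +
      Module.finrank 𝕜 (B x) = Module.finrank 𝕜 (Z x) := by
  rw [← Submodule.finrank_quotient_add_finrank ((B x).submoduleOf (Z x)),
    (Submodule.submoduleOfEquivOfLe (hBZ x)).finrank_eq]
  rfl

/-- Rank-nullity for the restriction of `f` to `C`. -/
theorem finrank_map_add_finrank_inf_ker {𝕜 : Type v} [Field 𝕜] {V : Type w₁} {W : Type w₂}
    [AddCommGroup V] [Module 𝕜 V] [Module.Finite 𝕜 V] [AddCommGroup W] [Module 𝕜 W]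
    (f : V →ₗ[𝕜] W) (C : Submodule 𝕜 V) :
    Module.finrank 𝕜 (C.map f) + Module.finrank 𝕜 (C ⊓ LinearMap.ker f : Submodule 𝕜 V) =
      Module.finrank 𝕜 C := by
  rw [← LinearMap.finrank_range_add_finrank_ker (f.domRestrict C), LinearMap.range_domRestrict,
    LinearMap.ker_domRestrict, ← Submodule.finrank_map_subtype_eq C, Submodule.map_comap_subtype]

/-! ### Dimensions of chains, cycles and boundaries -/

instance {X : Type u} [Finite X] (k : ℕ) : Finite (Tuple X k) := Subtype.finite

theorem chains_le_chains {X : Type u} [MetricSpace X] {𝕜 : Type v} [Field 𝕜] {k : ℕ} {l l' : ℝ}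
    (h : ∀ x : Tuple X k, length x.1 ≤ l' → length x.1 ≤ l) : chains X 𝕜 k l' ≤ chains X 𝕜 k l :=
  Finsupp.supported_mono fun x hx => h x hx

theorem cycles_le_cycles {X : Type u} [MetricSpace X] {𝕜 : Type v} [Field 𝕜] {k : ℕ} {l l' : ℝ}
    (h : ∀ x : Tuple X k, length x.1 ≤ l' → length x.1 ≤ l) :
    cycles X 𝕜 k l' ≤ cycles X 𝕜 k l := by
  cases k with
  | zero => exact chains_le_chains h
  | succ k => exact inf_le_inf_right _ (chains_le_chains h)

instance {X : Type u} [MetricSpace X] [Finite X] (𝕜 : Type v) [Field 𝕜] (k : ℕ) (l : ℝ) :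
    Module.Finite 𝕜 ((BMH X 𝕜 k).obj l) :=
  PersistenceModule.finite_subquotient_obj _ _ _ l

/-- Bars of `BMH_k(X)` are born at lengths of tuples. -/
theorem IsBarcode.mem_range_length {X : Type u} [MetricSpace X] [Finite X] {𝕜 : Type v} [Field 𝕜]
    {k : ℕ} {ι : Type w} {a : ι → ℝ} {b : ι → WithTop ℝ} (h : IsBarcode (BMH X 𝕜 k) a b) (i : ι) :
    a i ∈ Set.range fun x : Tuple X k => length x.1 := by
  by_contra hi
  have hU : (Set.range fun x : Tuple X k => length x.1)ᶜ ∈ nhds (a i) :=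
    (Set.finite_range _).isClosed.isOpen_compl.mem_nhds hi
  obtain ⟨ε, hε, hball⟩ := Metric.mem_nhds_iff.1 hU
  -- No tuple has length in `(a i - ε / 2, a i]`, so every cycle at `a i` already exists at `a i - ε
  -- / 2`.
  have hlt : a i - ε / 2 < a i := by linarith
  refine h.not_surjective_map i hlt (PersistenceModule.subquotient_map_surjective _ _ _ _
    (cycles_le_cycles fun x hx => ?_))
  by_contra! hx'
  refine hball (a := length x.1) ?_ ⟨x, rfl⟩
  rw [Metric.mem_ball, Real.dist_eq, abs_lt]
  constructor <;> linarith

/-- Each bar contains its left endpoint, a tuple length, so the finite sets of bars through the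
finitely many lengths cover `ι`. -/
theorem IsBarcode.finite_of_BMH {X : Type u} [MetricSpace X] [Finite X] {𝕜 : Type v} [Field 𝕜]
    {k : ℕ} {ι : Type w} {a : ι → ℝ} {b : ι → WithTop ℝ} (h : IsBarcode (BMH X 𝕜 k) a b) :
    Finite ι := by
  have hfin : (⋃ x : Tuple X k, {i | length x.1 ∈ bar (a i) (b i)}).Finite :=
    Set.finite_iUnion fun x => h.finite_setOf_mem_bar _
  refine Set.finite_univ_iff.1 (hfin.subset fun i _ => ?_)
  obtain ⟨x, hx⟩ := h.mem_range_length i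
  refine Set.mem_iUnion.2 ⟨x, ?_⟩
  simp only at hx
  rw [Set.mem_ofPred_eq, hx]
  exact ⟨le_rfl, h.1 i⟩

/-- A tuple behaves like a bar `[ℓ(x), ∞)`, so chains and homology are transformed by the same
formula. -/
theorem finrank_chains {X : Type u} [MetricSpace X] (𝕜 : Type v) [Field 𝕜] (k : ℕ)
    [Fintype (Tuple X k)] (l : ℝ) :
    (Module.finrank 𝕜 (chains X 𝕜 k l) : ℝ) =
      ∑ x : Tuple X k, (bar (length x.1) ⊤).indicator 1 l := by
  classical
  rw [chains, (Finsupp.supportedEquivFinsupp _).finrank_eq, Module.finrank_finsupp_self,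
    Fintype.card_subtype, Finset.card_filter]
  push_cast
  refine Finset.sum_congr rfl fun x _ => ?_
  simp [Set.indicator_apply, bar]

theorem finrank_cycles_add_finrank_boundaries (X : Type u) [MetricSpace X] [Finite X] (𝕜 : Type v)
    [Field 𝕜] (k : ℕ) (l : ℝ) :
    Module.finrank 𝕜 (boundaries X 𝕜 k l) + Module.finrank 𝕜 (cycles X 𝕜 (k + 1) l) =
      Module.finrank 𝕜 (chains X 𝕜 (k + 1) l) :=
  finrank_map_add_finrank_inf_ker _ _

theorem finrank_BMH_add_finrank_boundaries (X : Type u) [MetricSpace X] [Finite X] (𝕜 : Type v)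
    [Field 𝕜] (k : ℕ) (l : ℝ) :
    Module.finrank 𝕜 ((BMH X 𝕜 k).obj l) + Module.finrank 𝕜 (boundaries X 𝕜 k l) =
      Module.finrank 𝕜 (cycles X 𝕜 k l) :=
  PersistenceModule.finrank_subquotient_obj_add _ _ _ l

theorem finrank_boundaries_mono (X : Type u) [MetricSpace X] [Finite X] (𝕜 : Type v) [Field 𝕜]
    (k : ℕ) : Monotone fun l => (Module.finrank 𝕜 (boundaries X 𝕜 k l) : ℝ) :=
  fun _ _ h => Nat.cast_le.2 (Submodule.finrank_mono (boundaries_mono X 𝕜 k h))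

theorem finrank_boundaries_le (X : Type u) [MetricSpace X] [Finite X] (𝕜 : Type v) [Field 𝕜]
    (k : ℕ) (l : ℝ) :
    Module.finrank 𝕜 (boundaries X 𝕜 k l) ≤ Module.finrank 𝕜 (chains X 𝕜 k l) :=
  Submodule.finrank_mono (boundaries_le_chains X 𝕜 k l)

/-! ### The transform `g ↦ t ∫ g(l) e^{-tl} dl` -/

/-- The rescaled two-sided Laplace transform `t ∫ g(l) e^{-tl} dl` of `g`. -/
def laplace (t : ℝ) (g : ℝ → ℝ) : ℝ := t * ∫ l, g l * Real.exp (-t * l)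

/-- The integral defining `laplace t g` converges. -/
def LaplaceIntegrable (t : ℝ) (g : ℝ → ℝ) : Prop :=
  MeasureTheory.Integrable fun l => g l * Real.exp (-t * l)

theorem laplace_add {t : ℝ} {f g : ℝ → ℝ} (hf : LaplaceIntegrable t f)
    (hg : LaplaceIntegrable t g) : laplace t (fun l => f l + g l) = laplace t f + laplace t g := by
  simp only [laplace, add_mul]
  rw [MeasureTheory.integral_add hf hg, mul_add]

theorem LaplaceIntegrable.add {t : ℝ} {f g : ℝ → ℝ} (hf : LaplaceIntegrable t f)
    (hg : LaplaceIntegrable t g) : LaplaceIntegrable t fun l => f l + g l := by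
  simp only [LaplaceIntegrable, add_mul]
  exact MeasureTheory.Integrable.add hf hg

theorem LaplaceIntegrable.sum {t : ℝ} {ι : Type w} (s : Finset ι) {f : ι → ℝ → ℝ}
    (hf : ∀ i ∈ s, LaplaceIntegrable t (f i)) : LaplaceIntegrable t fun l => ∑ i ∈ s, f i l := by
  simp only [LaplaceIntegrable, Finset.sum_mul]
  exact MeasureTheory.integrable_finsetSum s hf

theorem laplace_sum {t : ℝ} {ι : Type w} (s : Finset ι) {f : ι → ℝ → ℝ}
    (hf : ∀ i ∈ s, LaplaceIntegrable t (f i)) :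
    laplace t (fun l => ∑ i ∈ s, f i l) = ∑ i ∈ s, laplace t (f i) := by
  simp only [laplace, Finset.sum_mul]
  rw [MeasureTheory.integral_finsetSum s hf, Finset.mul_sum]

theorem laplace_nonneg {t : ℝ} (ht : 0 ≤ t) {g : ℝ → ℝ} (hg : ∀ l, 0 ≤ g l) : 0 ≤ laplace t g :=
  mul_nonneg ht (MeasureTheory.integral_nonneg fun l => mul_nonneg (hg l) (Real.exp_nonneg _))

theorem laplace_mono {t : ℝ} (ht : 0 ≤ t) {f g : ℝ → ℝ} (hf : LaplaceIntegrable t f)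
    (hg : LaplaceIntegrable t g) (h : ∀ l, f l ≤ g l) : laplace t f ≤ laplace t g :=
  mul_le_mul_of_nonneg_left (MeasureTheory.integral_mono hf hg fun l =>
    mul_le_mul_of_nonneg_right (h l) (Real.exp_nonneg _)) ht

/-- Monotonicity supplies measurability. This serves the boundary dimensions, for which no
expression through indicators is at hand. -/
theorem LaplaceIntegrable.of_monotone {t : ℝ} {f g : ℝ → ℝ} (hg : LaplaceIntegrable t g)
    (hf : Monotone f) (h₀ : ∀ l, 0 ≤ f l) (h : ∀ l, f l ≤ g l) : LaplaceIntegrable t f := by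
  refine MeasureTheory.Integrable.mono' hg ?_ (Filter.Eventually.of_forall fun l => ?_)
  · exact (hf.measurable.mul (by fun_prop)).aestronglyMeasurable
  · rw [Real.norm_of_nonneg (mul_nonneg (h₀ l) (Real.exp_nonneg _))]
    exact mul_le_mul_of_nonneg_right (h l) (Real.exp_nonneg _)

theorem bar_top (a : ℝ) : bar a ⊤ = Set.Ici a := by
  ext x
  simp [bar]

theorem bar_coe (a b : ℝ) : bar a (b : WithTop ℝ) = Set.Ico a b := by
  ext x
  simp [bar]

theorem indicator_mul_exp (J : Set ℝ) (t : ℝ) :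
    (fun l => J.indicator 1 l * Real.exp (-t * l)) =
      J.indicator fun l => Real.exp (-t * l) := by
  ext l
  by_cases h : l ∈ J <;> simp [h]

theorem laplaceIntegrable_indicator_bar {t : ℝ} (ht : 0 < t) (a : ℝ) (b : WithTop ℝ) :
    LaplaceIntegrable t ((bar a b).indicator 1) := by
  have hI : MeasureTheory.IntegrableOn (fun l => Real.exp (-t * l)) (Set.Ici a) :=
    (integrableOn_Ici_iff_integrableOn_Ioi).2 (integrableOn_exp_mul_Ioi (neg_neg_of_pos ht) a)
  rw [LaplaceIntegrable, indicator_mul_exp]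
  induction b using WithTop.recTopCoe with
  | top => rwa [bar_top, MeasureTheory.integrable_indicator_iff measurableSet_Ici]
  | coe b =>
    rw [bar_coe, MeasureTheory.integrable_indicator_iff measurableSet_Ico]
    exact hI.mono_set Set.Ico_subset_Ici_self

theorem laplace_indicator_bar_top {t : ℝ} (ht : 0 < t) (a : ℝ) :
    laplace t ((bar a ⊤).indicator 1) = Real.exp (-(a * t)) := by
  rw [laplace, indicator_mul_exp, bar_top, MeasureTheory.integral_indicator measurableSet_Ici,
    MeasureTheory.integral_Ici_eq_integral_Ioi, integral_exp_mul_Ioi (neg_neg_of_pos ht)]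
  field_simp

theorem laplace_indicator_bar {t : ℝ} (ht : 0 < t) {a : ℝ} {b : WithTop ℝ}
    (hab : (a : WithTop ℝ) < b) :
    laplace t ((bar a b).indicator 1) = Real.exp (-(a * t)) - expNegMul b t := by
  induction b using WithTop.recTopCoe with
  | top => simp [laplace_indicator_bar_top ht, expNegMul]
  | coe b =>
    have h := laplace_add (laplaceIntegrable_indicator_bar ht a (b : WithTop ℝ))
      (laplaceIntegrable_indicator_bar ht b ⊤)
    have hab' : a < b := WithTop.coe_lt_coe.1 hab
    -- `[a, ∞)` is the disjoint union of `[a, b)` and `[b, ∞)`, which reduces the finite bar to two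
    -- infinite ones.
    have e : (fun l => (bar a (b : WithTop ℝ)).indicator 1 l + (bar b ⊤).indicator 1 l) =
        (bar a ⊤).indicator (1 : ℝ → ℝ) := by
      rw [bar_coe, bar_top, bar_top, ← Set.Ico_union_Ici_eq_Ici hab'.le,
        Set.indicator_union_of_disjoint]
      exact Set.disjoint_left.2 fun x hx hx' => hx.2.not_ge hx'
    rw [e, laplace_indicator_bar_top ht, laplace_indicator_bar_top ht] at h
    simp [expNegMul, h]

/-! ### Sums over paths and the magnitude -/

/-- The sum over all `(y₁, …, yₖ)` of `A x y₁ * A y₁ y₂ * ⋯ * A yₖ₋₁ yₖ`. -/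
def pathSum {X : Type u} [Fintype X] (A : X → X → ℝ) : ℕ → X → ℝ
  | 0, _ => 1
  | k + 1, x => ∑ y, A x y * pathSum A k y

/-- The free weight `F` on the first entry drives the induction: splitting off the first entry `y`
leaves a shorter sum with weight `A y`. -/
theorem sum_mul_prod_eq_sum_mul_pathSum {X : Type u} [Fintype X] (A : X → X → ℝ) (k : ℕ)
    (F : X → ℝ) :
    ∑ x : Fin (k + 1) → X, F (x 0) * ∏ i : Fin k, A (x i.castSucc) (x i.succ) =
      ∑ x, F x * pathSum A k x := by
  induction k generalizing F with
  | zero =>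
    rw [← (Equiv.funUnique (Fin 1) X).sum_comp]
    simp [pathSum]
  | succ k ih =>
    rw [← (Fin.consEquiv fun _ : Fin (k + 2) => X).sum_comp, Fintype.sum_prod_type]
    refine Finset.sum_congr rfl fun y _ => ?_
    rw [pathSum, ← ih (A y), Finset.mul_sum]
    refine Finset.sum_congr rfl fun z _ => ?_
    simp [Fin.consEquiv, Fin.prod_univ_succ]

theorem pathSum_nonneg {X : Type u} [Fintype X] {A : X → X → ℝ} (hA : ∀ x y, 0 ≤ A x y) (k : ℕ)
    (x : X) : 0 ≤ pathSum A k x := by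
  induction k generalizing x with
  | zero => exact zero_le_one
  | succ k ih => exact Finset.sum_nonneg fun y _ => mul_nonneg (hA x y) (ih y)

theorem pathSum_le_pow {X : Type u} [Fintype X] {A : X → X → ℝ} (hA : ∀ x y, 0 ≤ A x y) {q : ℝ}
    (hq : 0 ≤ q) (hAq : ∀ x, ∑ y, A x y ≤ q) (k : ℕ) (x : X) : pathSum A k x ≤ q ^ k := by
  induction k generalizing x with
  | zero => exact le_rfl
  | succ k ih =>
    calc ∑ y, A x y * pathSum A k y ≤ ∑ y, A x y * q ^ k :=
          Finset.sum_le_sum fun y _ => mul_le_mul_of_nonneg_left (ih y) (hA x y)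
      _ = (∑ y, A x y) * q ^ k := by rw [Finset.sum_mul]
      _ ≤ q * q ^ k := mul_le_mul_of_nonneg_right (hAq x) (pow_nonneg hq k)
      _ = q ^ (k + 1) := (pow_succ' q k).symm

theorem summable_pathSum {X : Type u} [Fintype X] {A : X → X → ℝ} (hA : ∀ x y, 0 ≤ A x y) {q : ℝ}
    (hq : 0 ≤ q) (hq1 : q < 1) (hAq : ∀ x, ∑ y, A x y ≤ q) (x : X) :
    Summable fun k => pathSum A k x :=
  Summable.of_nonneg_of_le (fun k => pathSum_nonneg hA k x) (fun k => pathSum_le_pow hA hq hAq k x)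
    (summable_geometric_of_lt_one hq hq1)

theorem summable_neg_one_pow_mul {f : ℕ → ℝ} (hf : Summable f) (h₀ : ∀ k, 0 ≤ f k) :
    Summable fun k => (-1 : ℝ) ^ k * f k := by
  refine Summable.of_norm ?_
  simpa [abs_of_nonneg (h₀ _)] using hf

/-- The Neumann series of `(1 + A)⁻¹` applied to the constant function `1`. -/
theorem tsum_pathSum_add {X : Type u} [Fintype X] {A : X → X → ℝ} (hA : ∀ x y, 0 ≤ A x y)
    (hs : ∀ x, Summable fun k => pathSum A k x) (x : X) :
    (∑' k, (-1 : ℝ) ^ k * pathSum A k x) +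
      ∑ y, A x y * ∑' k, (-1 : ℝ) ^ k * pathSum A k y = 1 := by
  have hs' x := summable_neg_one_pow_mul (hs x) fun k => pathSum_nonneg hA k x
  -- Applying `A` shifts the path sums by one index, so the two series cancel except for the term `k
  -- = 0`.
  have h : ∑ y, A x y * ∑' k, (-1 : ℝ) ^ k * pathSum A k y =
      ∑' k, (-1 : ℝ) ^ k * pathSum A (k + 1) x := by
    simp_rw [← tsum_mul_left]
    rw [← Summable.tsum_finsetSum fun y _ => (hs' y).mul_left _]
    refine tsum_congr fun k => ?_
    rw [pathSum, Finset.mul_sum]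
    exact Finset.sum_congr rfl fun y _ => by ring
  rw [h, (hs' x).tsum_eq_zero_add]
  simp only [pow_succ, mul_neg_one, neg_mul, tsum_neg]
  simp [pathSum]

/-- The magnitude of a symmetric distance function can be computed from any weighting. -/
theorem IsWeighting.hasMagnitude {X : Type u} [Fintype X] {d : X → X → ℝ}
    (hd : ∀ x y, d x y = d y x) {w : X → ℝ} (hw : IsWeighting d w) : HasMagnitude d (∑ x, w x) := by
  refine ⟨⟨w, hw⟩, fun w' hw' => ?_⟩
  -- Evaluate the double sum of `w' x * exp (-d x y) * w y` in both orders.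
  calc ∑ x, w' x = ∑ x, w' x * ∑ y, Real.exp (-d x y) * w y := by simp [hw _]
    _ = ∑ y, ∑ x, w' x * (Real.exp (-d x y) * w y) := by
      simp_rw [Finset.mul_sum]
      exact Finset.sum_comm
    _ = ∑ y, w y * ∑ x, Real.exp (-d y x) * w' x := by
      simp_rw [Finset.mul_sum]
      refine Finset.sum_congr rfl fun y _ => Finset.sum_congr rfl fun x _ => ?_
      rw [hd x y]
      ring
    _ = ∑ y, w y := by simp [hw' _]

open Classical in
/-- The off-diagonal part of the similarity matrix of `tX`. -/
def offDiagSimilarity (X : Type u) [MetricSpace X] (t : ℝ) (x y : X) : ℝ :=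
  if x = y then 0 else Real.exp (-(t * dist x y))

theorem offDiagSimilarity_nonneg {X : Type u} [MetricSpace X] (t : ℝ) (x y : X) :
    0 ≤ offDiagSimilarity X t x y := by
  unfold offDiagSimilarity
  split_ifs
  · exact le_rfl
  · exact Real.exp_nonneg _

theorem sum_exp_neg_mul_eq {X : Type u} [MetricSpace X] [Fintype X] (t : ℝ) (w : X → ℝ) (x : X) :
    ∑ y, Real.exp (-(t * dist x y)) * w y = w x + ∑ y, offDiagSimilarity X t x y * w y := by
  classical
  have h (y : X) : Real.exp (-(t * dist x y)) * w y =
      (if x = y then w y else 0) + offDiagSimilarity X t x y * w y := by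
    by_cases hxy : x = y
    · simp [offDiagSimilarity, hxy]
    · simp [offDiagSimilarity, hxy]
  simp_rw [h, Finset.sum_add_distrib]
  simp

theorem prod_offDiagSimilarity {X : Type u} [MetricSpace X] (t : ℝ) {k : ℕ} (x : Tuple X k) :
    ∏ i : Fin k, offDiagSimilarity X t (x.1 i.castSucc) (x.1 i.succ) =
      Real.exp (-(length x.1 * t)) := by
  rw [length, Finset.sum_mul, ← Finset.sum_neg_distrib, Real.exp_sum]
  refine Finset.prod_congr rfl fun i _ => ?_
  rw [offDiagSimilarity, if_neg (x.2 i), mul_comm]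

theorem prod_offDiagSimilarity_eq_zero {X : Type u} [MetricSpace X] (t : ℝ) {k : ℕ}
    {x : Fin (k + 1) → X} (hx : ¬ Nondegenerate x) :
    ∏ i : Fin k, offDiagSimilarity X t (x i.castSucc) (x i.succ) = 0 := by
  obtain ⟨j, hj⟩ : ∃ j : Fin k, x j.castSucc = x j.succ := by
    simpa [Nondegenerate] using hx
  exact Finset.prod_eq_zero (Finset.mem_univ j) (by simp [offDiagSimilarity, hj])

/-- Degenerate tuples contribute zero to the path sum because `A` vanishes on the diagonal. -/
theorem sum_exp_neg_length {X : Type u} [MetricSpace X] [Fintype X] (t : ℝ) (k : ℕ)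
    [Fintype (Tuple X k)] :
    ∑ x : Tuple X k, Real.exp (-(length x.1 * t)) =
      ∑ x, pathSum (offDiagSimilarity X t) k x := by
  classical
  have h := sum_mul_prod_eq_sum_mul_pathSum (offDiagSimilarity X t) k fun _ => 1
  simp only [one_mul] at h
  rw [← h, ← Finset.sum_subset (Finset.filter_subset Nondegenerate Finset.univ)
    fun x _ hx => prod_offDiagSimilarity_eq_zero t (by simpa using hx),
    Finset.sum_subtype (p := Nondegenerate) (F := ‹_›) _ (by simp)]
  exact Finset.sum_congr rfl fun x _ => (prod_offDiagSimilarity t x).symm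

theorem exists_forall_le_dist (X : Type u) [MetricSpace X] [Finite X] :
    ∃ δ : ℝ, 0 < δ ∧ ∀ x y : X, x ≠ y → δ ≤ dist x y := by
  cases isEmpty_or_nonempty {p : X × X // p.1 ≠ p.2} with
  | inl h => exact ⟨1, one_pos, fun x y hxy => (h.false ⟨(x, y), hxy⟩).elim⟩
  | inr h =>
    obtain ⟨p, hp⟩ := Finite.exists_min fun p : {p : X × X // p.1 ≠ p.2} => dist p.1.1 p.1.2
    exact ⟨_, dist_pos.2 p.2, fun x y hxy => hp ⟨(x, y), hxy⟩⟩

/-- With `δ` a lower bound for the nonzero distances, a row sum is at most `|X| e^{-tδ}`, which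
tends to `0`. Any constant below `1` would serve in place of `1 / 2`. -/
theorem exists_sum_offDiagSimilarity_le (X : Type u) [MetricSpace X] [Fintype X] :
    ∃ T : ℝ, 0 < T ∧ ∀ t, T < t → ∀ x : X, ∑ y, offDiagSimilarity X t x y ≤ 1 / 2 := by
  obtain ⟨δ, hδ, hX⟩ := exists_forall_le_dist X
  have hlim : Filter.Tendsto (fun t : ℝ => Fintype.card X * Real.exp (-(t * δ))) Filter.atTop
      (nhds (Fintype.card X * 0)) :=
    (Real.tendsto_exp_neg_atTop_nhds_zero.comp
      (Filter.tendsto_id.atTop_mul_const hδ)).const_mul _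
  rw [mul_zero] at hlim
  obtain ⟨T, hT⟩ := Filter.eventually_atTop.1 (hlim.eventually_le_const one_half_pos)
  refine ⟨max T 1, by positivity, fun t ht x => ?_⟩
  have ht0 : 0 < t := one_pos.trans ((le_max_right T 1).trans_lt ht)
  calc ∑ y, offDiagSimilarity X t x y ≤ ∑ _y : X, Real.exp (-(t * δ)) := by
        refine Finset.sum_le_sum fun y _ => ?_
        unfold offDiagSimilarity
        split_ifs with hxy
        · exact Real.exp_nonneg _
        · exact Real.exp_le_exp.2 (neg_le_neg (mul_le_mul_of_nonneg_left (hX x y hxy) ht0.le))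
    _ = Fintype.card X * Real.exp (-(t * δ)) := by simp
    _ ≤ 1 / 2 := hT t ((le_max_left T 1).trans ht.le)

/-- For large `t`, the magnitude of `tX` is the alternating sum over all tuples of
`e^{-tℓ(x₀, …, xₖ)}`. -/
theorem exists_hasMagnitude_hasSum {X : Type u} [MetricSpace X] [Fintype X] {t : ℝ}
    (ht : ∀ x : X, ∑ y, offDiagSimilarity X t x y ≤ 1 / 2) :
    (Summable fun k => ∑ x, pathSum (offDiagSimilarity X t) k x) ∧
    ∃ m, HasMagnitude (fun x y : X => t * dist x y) m ∧
      HasSum (fun k => (-1 : ℝ) ^ k * ∑ x, pathSum (offDiagSimilarity X t) k x) m := by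
  have hs := summable_pathSum (offDiagSimilarity_nonneg (X := X) t) one_half_pos.le
    one_half_lt_one ht
  refine ⟨summable_sum fun x _ => hs x, _,
    IsWeighting.hasMagnitude (fun x y => by rw [dist_comm])
      (w := fun x => ∑' k, (-1 : ℝ) ^ k * pathSum (offDiagSimilarity X t) k x) fun x => ?_, ?_⟩
  · rw [sum_exp_neg_mul_eq]
    exact tsum_pathSum_add (offDiagSimilarity_nonneg t) hs x
  · simp_rw [Finset.mul_sum]
    exact hasSum_sum fun x _ => (summable_neg_one_pow_mul (hs x) fun k =>
      pathSum_nonneg (offDiagSimilarity_nonneg t) k x).hasSum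

/-! ### The alternating sum over the bars -/

/-- Euler characteristic of an infinite complex: passing to homology does not change the
alternating sum. -/
theorem hasSum_neg_one_pow_mul_of_add_eq {N H B : ℕ → ℝ} {m : ℝ} (hN : Summable N)
    (hB₀ : ∀ k, 0 ≤ B k) (hBN : ∀ k, B k ≤ N k) (h_zero : H 0 + B 0 = N 0)
    (h_succ : ∀ k, H (k + 1) + B (k + 1) + B k = N (k + 1))
    (hm : HasSum (fun k => (-1 : ℝ) ^ k * N k) m) : HasSum (fun k => (-1 : ℝ) ^ k * H k) m := by
  have hB := (summable_neg_one_pow_mul (Summable.of_nonneg_of_le hB₀ hBN hN) hB₀).hasSum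
  -- Drop the term `k = 0` from the series of `(-1)^k (N k - B k)`; adding the unshifted series of
  -- `(-1)^k B k` then leaves `(-1)^(k+1) H (k+1)`.
  have h0 := (hasSum_nat_add_iff' 1).2 (hm.sub hB)
  refine (hasSum_nat_add_iff' 1).1 ?_
  convert h0.add hB using 1
  · ext k
    rw [← h_succ k]
    ring
  · simp [← h_zero]
    ring

theorem laplaceIntegrable_finrank_chains {X : Type u} [MetricSpace X] [Finite X] (𝕜 : Type v)
    [Field 𝕜] (k : ℕ) {t : ℝ} (ht : 0 < t) :
    LaplaceIntegrable t fun l => (Module.finrank 𝕜 (chains X 𝕜 k l) : ℝ) := by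
  have := Fintype.ofFinite (Tuple X k)
  simp only [finrank_chains]
  exact LaplaceIntegrable.sum _ fun x _ => laplaceIntegrable_indicator_bar ht _ _

theorem laplace_finrank_chains {X : Type u} [MetricSpace X] [Fintype X] (𝕜 : Type v)
    [Field 𝕜] (k : ℕ) {t : ℝ} (ht : 0 < t) :
    laplace t (fun l => (Module.finrank 𝕜 (chains X 𝕜 k l) : ℝ)) =
      ∑ x, pathSum (offDiagSimilarity X t) k x := by
  have := Fintype.ofFinite (Tuple X k)
  simp only [finrank_chains]
  rw [laplace_sum _ fun x _ => laplaceIntegrable_indicator_bar ht _ _, ← sum_exp_neg_length]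
  exact Finset.sum_congr rfl fun x _ => laplace_indicator_bar_top ht _

theorem laplaceIntegrable_finrank_boundaries {X : Type u} [MetricSpace X] [Finite X] (𝕜 : Type v)
    [Field 𝕜] (k : ℕ) {t : ℝ} (ht : 0 < t) :
    LaplaceIntegrable t fun l => (Module.finrank 𝕜 (boundaries X 𝕜 k l) : ℝ) :=
  (laplaceIntegrable_finrank_chains 𝕜 k ht).of_monotone (finrank_boundaries_mono X 𝕜 k)
    (fun _ => Nat.cast_nonneg _) fun l => Nat.cast_le.2 (finrank_boundaries_le X 𝕜 k l)

theorem IsBarcode.laplaceIntegrable_finrank {𝕜 : Type v} [Field 𝕜]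
    {M : PersistenceModule.{v, w₁} 𝕜} {ι : Type w} [Finite ι] {a : ι → ℝ} {b : ι → WithTop ℝ}
    (h : IsBarcode M a b) {t : ℝ} (ht : 0 < t) :
    LaplaceIntegrable t fun l => (Module.finrank 𝕜 (M.obj l) : ℝ) := by
  have := Fintype.ofFinite ι
  simp only [h.finrank_obj]
  exact LaplaceIntegrable.sum _ fun i _ => laplaceIntegrable_indicator_bar ht _ _

theorem IsBarcode.laplace_finrank {𝕜 : Type v} [Field 𝕜]
    {M : PersistenceModule.{v, w₁} 𝕜} {ι : Type w} [Finite ι] {a : ι → ℝ} {b : ι → WithTop ℝ}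
    (h : IsBarcode M a b) {t : ℝ} (ht : 0 < t) :
    laplace t (fun l => (Module.finrank 𝕜 (M.obj l) : ℝ)) =
      ∑' i, (Real.exp (-(a i * t)) - expNegMul (b i) t) := by
  have := Fintype.ofFinite ι
  simp only [h.finrank_obj]
  rw [laplace_sum _ fun i _ => laplaceIntegrable_indicator_bar ht _ _, tsum_fintype]
  exact Finset.sum_congr rfl fun i _ => laplace_indicator_bar ht (h.1 i)

end BlurredMagnitude

end

open BlurredMagnitude in
theorem mainTheorem1 {X : Type u} [MetricSpace X] [Fintype X] (𝕜 : Type v) [Field 𝕜] :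
    ∃ T : ℝ, 0 < T ∧
      ∀ (ι : ℕ → Type w) (a : ∀ k, ι k → ℝ) (b : ∀ k, ι k → WithTop ℝ),
        (∀ k, BlurredMagnitude.IsBarcode (BlurredMagnitude.BMH X 𝕜 k) (a k) (b k)) →
        (∀ k, Finite (ι k)) ∧
        ∀ t : ℝ, T < t →
          ∃ m : ℝ,
            BlurredMagnitude.HasMagnitude (fun x y : X => t * dist x y) m ∧
            HasSum
              (fun k : ℕ => ∑' i : ι k,
                (-1 : ℝ) ^ k *
                  (Real.exp (-(a k i * t)) - BlurredMagnitude.expNegMul (b k i) t))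
              m := by
  obtain ⟨T, hT0, hT⟩ := exists_sum_offDiagSimilarity_le X
  refine ⟨T, hT0, fun ι a b h => ?_⟩
  have hfin k : Finite (ι k) := (h k).finite_of_BMH
  refine ⟨hfin, fun t ht => ?_⟩
  have ht0 : 0 < t := hT0.trans ht
  obtain ⟨hs, m, hm, hsum⟩ := exists_hasMagnitude_hasSum (hT t ht)
  refine ⟨m, hm, ?_⟩
  have hI k := (h k).laplaceIntegrable_finrank ht0
  have hB k := laplaceIntegrable_finrank_boundaries (X := X) 𝕜 k ht0
  simp_rw [tsum_mul_left, ← (h _).laplace_finrank ht0]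
  simp_rw [← laplace_finrank_chains 𝕜 _ ht0] at hs hsum
  -- Here `N`, `H`, `B` are the transforms of the dimensions of chains, homology and boundaries.
  refine hasSum_neg_one_pow_mul_of_add_eq hs
    (B := fun k => laplace t fun l => (Module.finrank 𝕜 (boundaries X 𝕜 k l) : ℝ))
    (fun k => laplace_nonneg ht0.le fun l => Nat.cast_nonneg _)
    (fun k => laplace_mono ht0.le (hB k) (laplaceIntegrable_finrank_chains 𝕜 k ht0)
      fun l => Nat.cast_le.2 (finrank_boundaries_le X 𝕜 k l)) ?_ (fun k => ?_) hsum
  -- In degree `0` all chains are cycles, so there is no term from a lower boundary space.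
  · rw [← laplace_add (hI 0) (hB 0)]
    congr 1
    ext l
    exact_mod_cast finrank_BMH_add_finrank_boundaries X 𝕜 0 l
  · rw [← laplace_add (hI (k + 1)) (hB (k + 1)), ← laplace_add _ (hB k)]
    · congr 1
      ext l
      have h₁ := finrank_BMH_add_finrank_boundaries X 𝕜 (k + 1) l
      have h₂ := finrank_cycles_add_finrank_boundaries X 𝕜 k l
      rw [← h₂, ← h₁]
      push_cast
      ring
    · exact (hI (k + 1)).add (hB (k + 1))
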